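/- Let $M \in \mathbb{R}$. There is a constant $C > 0$, depending only on $M$, such that the following holds for every $n \geq 1$ and every bounded continuous function $V : \mathbb{R}^n \to \mathbb{R}$ with $0 < V(x) \leq M$ for all $x \in \mathbb{R}^n$. Let $(u_0, u_1) \in H^1(\mathbb{R}^n) \times L^2(\mathbb{R}^n)$ be real-valued initial data such that $$K_0^2 := \int_{\mathbb{R}^n} \frac{|u_1(x) + u_0(x)|^2}{V(x)}\, dx < \infty.$$ Then the Cauchy problem $$u_{tt} - \Delta u + V(x) u + u_t = 0 \quad (t > 0,\ x \in \mathbb{R}^n), \qquad u(0,x) = u_0(x), \quad u_t(0,x) = u_1(x),$$ has a unique weak solution $u \in C([0,\infty); H^1(\mathbb{R}^n)) \cap C^1([0,\infty); L^2(\mathbb{R}^n))$, where weak solution means that for every $\varphi \in H^1(\mathbb{R}^n)$ and every $t > 0$ $$\frac{d}{dt}(u_t(t,\cdot), \varphi) + (\nabla u(t,\cdot), \nabla\varphi) + (V u(t,\cdot), \varphi) + (u_t(t,\cdot), \varphi) = 0$$ with $(\cdot,\cdot)$ the $L^2(\mathbb{R}^n)$ inner product. With the energy $$E(t) := \frac12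 \int_{\mathbb{R}^n} \left( |u_t(t,x)|^2 + |\nabla u(t,x)|^2 + V(x) |u(t,x)|^2 \right) dx$$ and $\|\cdot\|$ the norm of $L^2(\mathbb{R}^n)$, this solution satisfies, for all $t \geq 0$, $$(1+t)^2 E(t) \leq C \left( \|u_0\|^2 + \|u_1\|^2 + \|\nabla u_0\|^2 + K_0^2 \right),$$ $$(1+t) \|u(t,\cdot)\|^2 \leq C \left( \|u_0\|^2 + \|u_1\|^2 + \|\nabla u_0\|^2 + K_0^2 \right).$$ -/

import Mathlib

open MeasureTheory Set
open scoped ContDiff BoundedContinuousFunction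

noncomputable section

namespace DampedWave

/-- The Euclidean space `ℝⁿ`. -/
abbrev Space (n : ℕ) : Type := EuclideanSpace ℝ (Fin n)

/-- The real-valued Lebesgue space `L²(ℝⁿ)`. -/
abbrev L2 (n : ℕ) : Type := Lp ℝ 2 (volume : Measure (Space n))

/-- The space `L²(ℝⁿ; ℝⁿ)` of square integrable vector fields. -/
abbrev L2Vec (n : ℕ) : Type := Lp (Space n) 2 (volume : Measure (Space n))

/-- `G` is the weak gradient of `f`: integration by parts holds against every `φ ∈ C₀^∞(ℝⁿ)`.
The function `f ∈ L²(ℝⁿ)` belongs to `H¹(ℝⁿ)` if and only if such a `G ∈ L²(ℝⁿ; ℝⁿ)` exists. -/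
def HasWeakGradient {n : ℕ} (f : L2 n) (G : L2Vec n) : Prop :=
  ∀ φ : Space n → ℝ, ContDiff ℝ ∞ φ → HasCompactSupport φ → ∀ i : Fin n,
    ∫ x, f x * fderiv ℝ φ x (EuclideanSpace.single i 1) = -∫ x, G x i * φ x

/-- `u` is a weak solution, in the class `C([0,∞); H¹(ℝⁿ)) ∩ C¹([0,∞); L²(ℝⁿ))`, of
`u_tt - Δu + V u + u_t = 0` on `(0,∞) × ℝⁿ` with `u(0) = u₀` and `u_t(0) = u₁`.
The curves `ut` and `Du` are the time derivative and the spatial gradient of `u`; only the values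
at times `t ≥ 0` matter. The continuity of `u` and `Du` in `L²` is the continuity of `u` in `H¹`.
The equation is tested against every `φ ∈ H¹(ℝⁿ)` (with weak gradient `Φ`):
`d/dt (u_t, φ) + (∇u, ∇φ) + (V u, φ) + (u_t, φ) = 0` for `t > 0`. -/
structure IsWeakSolution {n : ℕ} (V : Space n →ᵇ ℝ) (u₀ u₁ : L2 n)
    (u ut : ℝ → L2 n) (Du : ℝ → L2Vec n) : Prop where
  hasWeakGradient : ∀ t, 0 ≤ t → HasWeakGradient (u t) (Du t)
  continuousOn : ContinuousOn u (Ici 0)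
  continuousOn_gradient : ContinuousOn Du (Ici 0)
  hasDerivWithinAt : ∀ t, 0 ≤ t → HasDerivWithinAt u (ut t) (Ici 0) t
  continuousOn_deriv : ContinuousOn ut (Ici 0)
  initial : u 0 = u₀
  initial_deriv : ut 0 = u₁
  equation : ∀ (φ : L2 n) (Φ : L2Vec n), HasWeakGradient φ Φ → ∀ t, 0 < t →
    HasDerivAt (fun s => ∫ x, ut s x * φ x)
      (-((∫ x, inner ℝ (Du t x) (Φ x)) + (∫ x, V x * u t x * φ x) + ∫ x, ut t x * φ x)) t

/-- The total energy `½ ∫ (|u_t|² + |∇u|² + V |u|²) dx` of a state with displacement `f`,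
velocity `g` and displacement gradient `G`. -/
def energy {n : ℕ} (V : Space n →ᵇ ℝ) (f g : L2 n) (G : L2Vec n) : ℝ :=
  (1 / 2) * ∫ x, (|g x| ^ 2 + ‖G x‖ ^ 2 + V x * |f x| ^ 2)

end DampedWave

end

/-! With `D f = (∇f, √V f)` on H¹, the equation reads u'' + D*Du + u' = 0, and the energy is ½(‖v‖²
+ ‖F‖²) with v = u', F = Du. The pair (v, F) evolves by an m-dissipative generator on a Hilbert
space that does not contain u itself, so no positive lower bound on V is needed. Hille–Yosida theory
gives a mild solution, and u is recovered by integrating v.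

Decay rests on three multiplier identities. The energy E satisfies E' = -‖v‖²; Y = ⟨v, u⟩ + ½‖u‖²
satisfies Y' = ‖v‖² - ‖F‖². Integrating the equation in time gives v + u + D*∫F = u₀ + u₁, and
pairing this with u shows that Z = ½(‖u‖² + ‖∫F‖²) - ⟨u₀ + u₁, ∫u⟩ satisfies Z' = -‖u‖². Then
(1+t)²E + (1+t)(Y + 2E) + Y + 3E + Z is nonincreasing (`decay_of_energy_identity`).

The only term without a sign is ⟨u₀ + u₁, ∫u⟩. By Young's inequality with weights 1/V and V
(`inner_add_le`) it is at most ½K₀² + ½‖√V ∫u‖², and since √V u is a component of F the last term is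
absorbed by ½‖∫F‖².

The identity for E needs strong solutions, so the decay bound is proved for resolvent
regularizations and passed to the limit. Uniqueness uses only Z, whose identity holds for every weak
solution. -/

noncomputable section

namespace DampedWave

open Filter Topology NormedSpace

/-! ### Resolvents and Yosida approximations of m-dissipative relations. -/

section HilleYosida

variable {X : Type*} [NormedAddCommGroup X] [InnerProductSpace ℝ X]

/-- A linear relation `R` on a Hilbert space, read as the graph of an unbounded operator, is
m-dissipative: it is single valued and dissipative, and `1 - lR` is onto for every `l > 0`. -/
structure IsMDissipative (R : Submodule ℝ (X × X)) : Prop where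
  eq_zero_of_zero_mem : ∀ y, ((0 : X), y) ∈ R → y = 0
  inner_nonpos : ∀ x y, (x, y) ∈ R → inner ℝ y x ≤ 0
  exists_sub_smul_eq : ∀ l : ℝ, 0 < l → ∀ z, ∃ x y, (x, y) ∈ R ∧ x - l • y = z

variable {R : Submodule ℝ (X × X)}

/-- Expand ‖x - ly‖² = ‖x‖² - 2l⟨x, y⟩ + l²‖y‖²: dissipativity makes the cross term nonnegative. -/
theorem IsMDissipative.norm_le (hR : IsMDissipative R) {x y : X} (h : (x, y) ∈ R) {l : ℝ}
    (hl : 0 < l) : ‖x‖ ≤ ‖x - l • y‖ := by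
  have h1 := hR.inner_nonpos x y h
  have h2 := norm_sub_sq_real x (l • y)
  rw [inner_smul_right, real_inner_comm] at h2
  refine le_of_sq_le_sq ?_ (norm_nonneg _)
  nlinarith [sq_nonneg ‖l • y‖, mul_nonneg hl.le (neg_nonneg.2 h1)]

/-- The resolvent `(1 - lR)⁻¹` of an m-dissipative relation is an everywhere defined contraction. -/
theorem IsMDissipative.exists_resolvent (hR : IsMDissipative R) {l : ℝ} (hl : 0 < l) :
    ∃ J : X →L[ℝ] X, (∀ z, ‖J z‖ ≤ ‖z‖) ∧ (∀ z, (J z, l⁻¹ • (J z - z)) ∈ R) ∧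
      ∀ x y, (x, y) ∈ R → J (x - l • y) = x := by
  let T : R →ₗ[ℝ] X := (LinearMap.fst ℝ X X - l • LinearMap.snd ℝ X X) ∘ₗ R.subtype
  have hT : ∀ p : R, T p = p.1.1 - l • p.1.2 := fun p => rfl
  have hnorm : ∀ p : R, ‖p.1.1‖ ≤ ‖T p‖ := fun p => hR.norm_le p.2 hl
  have hinj : Function.Injective T := by
    rw [← LinearMap.ker_eq_bot, LinearMap.ker_eq_bot']
    intro p hp
    have h1 : p.1.1 = 0 := by
      have := hnorm p
      rw [hp, norm_zero] at this
      exact norm_le_zero_iff.1 this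
    have h2 : p.1.2 = 0 := by
      have := hT p
      rw [hp, h1, zero_sub, eq_comm, neg_eq_zero, smul_eq_zero] at this
      exact this.resolve_left hl.ne'
    exact Subtype.ext (Prod.ext h1 h2)
  have hsurj : Function.Surjective T := by
    intro z
    obtain ⟨x, y, h, hz⟩ := hR.exists_sub_smul_eq l hl z
    exact ⟨⟨(x, y), h⟩, hz⟩
  let e := LinearEquiv.ofBijective T ⟨hinj, hsurj⟩
  have he : ∀ z, T (e.symm z) = z := fun z => e.apply_symm_apply z
  let J : X →ₗ[ℝ] X := LinearMap.fst ℝ X X ∘ₗ R.subtype ∘ₗ e.symm.toLinearMap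
  have hJ : ∀ z, J z = (e.symm z).1.1 := fun z => rfl
  have hJn : ∀ z, ‖J z‖ ≤ 1 * ‖z‖ := fun z => by
    simpa [hJ, he] using hnorm (e.symm z)
  refine ⟨J.mkContinuous 1 hJn, fun z => by simpa using hJn z, fun z => ?_, fun x y h => ?_⟩
  · have h1 := he z
    rw [hT] at h1
    have h2 : l⁻¹ • (J z - z) = (e.symm z).1.2 := by
      rw [hJ]
      nth_rw 2 [← h1]
      rw [sub_sub_cancel, inv_smul_smul₀ hl.ne']
    rw [LinearMap.mkContinuous_apply, h2, hJ]
    exact (e.symm z).2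
  · have : e.symm (x - l • y) = ⟨(x, y), h⟩ := by
      rw [LinearEquiv.symm_apply_eq]
      rfl
    rw [LinearMap.mkContinuous_apply, hJ, this]

/-- The resolvent `(1 - lR)⁻¹` of an m-dissipative relation. -/
def IsMDissipative.resolvent (hR : IsMDissipative R) {l : ℝ} (hl : 0 < l) : X →L[ℝ] X :=
  (hR.exists_resolvent hl).choose

/-- The Yosida approximation `R (1 - lR)⁻¹` of an m-dissipative relation. -/
def IsMDissipative.yosida (hR : IsMDissipative R) {l : ℝ} (hl : 0 < l) : X →L[ℝ] X :=
  l⁻¹ • (hR.resolvent hl - 1)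

namespace IsMDissipative

variable (hR : IsMDissipative R) {l m : ℝ} (hl : 0 < l) (hm : 0 < m)

theorem norm_resolvent_le (z : X) : ‖hR.resolvent hl z‖ ≤ ‖z‖ :=
  (hR.exists_resolvent hl).choose_spec.1 z

theorem resolvent_yosida_mem (z : X) : (hR.resolvent hl z, hR.yosida hl z) ∈ R :=
  (hR.exists_resolvent hl).choose_spec.2.1 z

theorem resolvent_sub_smul {x y : X} (h : (x, y) ∈ R) : hR.resolvent hl (x - l • y) = x :=
  (hR.exists_resolvent hl).choose_spec.2.2 x y h

theorem resolvent_eq_add (z : X) : hR.resolvent hl z = z + l • hR.yosida hl z := by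
  simp [yosida, hl.ne']

/-- On the domain the Yosida approximation is the resolvent applied to `R x`, hence converges as `l
→ 0`. It also carries integrated equations to regularized curves. -/
theorem resolvent_eq_yosida {x y : X} (h : (x, y) ∈ R) :
    hR.resolvent hl y = hR.yosida hl x := by
  have h1 := hR.resolvent_sub_smul hl h
  rw [map_sub, map_smul, hR.resolvent_eq_add hl x] at h1
  have h2 : l • hR.resolvent hl y = l • hR.yosida hl x := by
    have : x + l • hR.yosida hl x - l • hR.resolvent hl y - x = 0 := by rw [h1, sub_self]
    have h3 : l • hR.yosida hl x - l • hR.resolvent hl y = 0 := by rw [← this]; abel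
    exact (sub_eq_zero.1 h3).symm
  exact smul_right_injective _ hl.ne' h2

theorem mem_of_resolvent_eq {x y : X} (h : hR.resolvent hl (x - l • y) = x) : (x, y) ∈ R := by
  have h1 := hR.resolvent_yosida_mem hl (x - l • y)
  have h2 := hR.resolvent_eq_add hl (x - l • y)
  rw [h] at h1 h2
  have : hR.yosida hl (x - l • y) = y := by
    have h3 : l • hR.yosida hl (x - l • y) = l • y := by
      have : x - (x - l • y) = l • hR.yosida hl (x - l • y) := by
        nth_rw 1 [h2]; abel
      rw [← this]; abel
    exact smul_right_injective _ hl.ne' h3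
  rwa [this] at h1

theorem isClosed (hR : IsMDissipative R) : IsClosed (R : Set (X × X)) := by
  have : (R : Set (X × X)) = {p | hR.resolvent one_pos (p.1 - (1 : ℝ) • p.2) = p.1} := by
    ext ⟨x, y⟩
    exact ⟨fun h => hR.resolvent_sub_smul one_pos h, fun h => hR.mem_of_resolvent_eq one_pos h⟩
  rw [this]
  exact isClosed_eq (by fun_prop) (by fun_prop)

theorem yosida_resolvent (z : X) :
    hR.yosida hl (hR.resolvent hm z) = hR.resolvent hl (hR.yosida hm z) :=
  (hR.resolvent_eq_yosida hl (hR.resolvent_yosida_mem hm z)).symm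

/-- The resolvent at `m` inverts `1 - mR`; applying `1 - mR` to J_l J_m z gives J_l (1 - mR) J_m z =
J_l z. -/
theorem resolvent_comm (z : X) :
    hR.resolvent hl (hR.resolvent hm z) = hR.resolvent hm (hR.resolvent hl z) := by
  have h1 := hR.yosida_resolvent hl hm z
  have h2 := hR.resolvent_eq_add hl (hR.resolvent hm z)
  refine (hR.resolvent_sub_smul hm (x := hR.resolvent hl (hR.resolvent hm z))
    (y := hR.yosida hl (hR.resolvent hm z)) (hR.resolvent_yosida_mem hl _)).symm.trans ?_
  congr 1
  rw [h1, ← map_smul, ← map_sub]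
  congr 1
  rw [hR.resolvent_eq_add hm z, add_sub_cancel_right]

theorem yosida_commute : Commute (hR.yosida hl) (hR.yosida hm) := by
  have : Commute (hR.resolvent hl) (hR.resolvent hm) := by
    ext z
    exact hR.resolvent_comm hl hm z
  unfold yosida
  exact (((this.sub_left (Commute.one_left _)).sub_right
    (Commute.one_right _)).smul_left _).smul_right _

theorem inner_yosida_nonpos (z : X) : inner ℝ z (hR.yosida hl z) ≤ 0 := by
  have h1 := hR.inner_nonpos _ _ (hR.resolvent_yosida_mem hl z)
  rw [hR.resolvent_eq_add hl z, inner_add_right, inner_smul_right, real_inner_comm] at h1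
  nlinarith [mul_nonneg hl.le (real_inner_self_nonneg (x := hR.yosida hl z))]

/-- If z is orthogonal to the domain, then ⟨Jz, z⟩ = 0 for the resolvent J at l = 1. Dissipativity
at (Jz, Jz - z) forces Jz = 0, so (0, -z) lies in `R` and single-valuedness gives z = 0. -/
theorem dense_domain (hR : IsMDissipative R) [CompleteSpace X] : Dense {x : X | ∃ y, (x, y) ∈ R} := by
  have : {x : X | ∃ y, (x, y) ∈ R} = (R.map (LinearMap.fst ℝ X X) : Set X) := by
    ext x
    simp
  rw [this, Submodule.dense_iff_topologicalClosure_eq_top,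
    Submodule.topologicalClosure_eq_top_iff, Submodule.eq_bot_iff]
  intro z hz
  have h0 := hR.resolvent_yosida_mem one_pos z
  have h1 : inner ℝ (hR.resolvent one_pos z) z = 0 :=
    (Submodule.mem_orthogonal _ _).1 hz _ ⟨_, h0, rfl⟩
  have h2 := hR.resolvent_eq_add one_pos z
  have h3 := hR.inner_nonpos _ _ h0
  have h4 : hR.yosida one_pos z = hR.resolvent one_pos z - z := by rw [h2, one_smul]; abel
  rw [h4, inner_sub_left, real_inner_comm _ z, h1, sub_zero] at h3
  have h5 : hR.resolvent one_pos z = 0 := by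
    rw [real_inner_self_eq_norm_sq] at h3
    exact norm_eq_zero.1 (pow_eq_zero_iff two_ne_zero |>.1 (le_antisymm h3 (sq_nonneg _)))
  rw [h5] at h0 h4
  have h6 := hR.eq_zero_of_zero_mem _ h0
  rw [h6, zero_sub] at h4
  exact neg_eq_zero.1 h4.symm

/-- The resolvents converge strongly to the identity. -/
theorem tendsto_resolvent [CompleteSpace X] {ι : Type*} {F : Filter ι} {l : ι → ℝ}
    (hl : ∀ i, 0 < l i) (h0 : Tendsto l F (𝓝 0)) {z : ι → X} {a : X} (hz : Tendsto z F (𝓝 a)) :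
    Tendsto (fun i => hR.resolvent (hl i) (z i)) F (𝓝 a) := by
  rw [Metric.tendsto_nhds]
  intro ε hε
  obtain ⟨x, hx, y, hxy⟩ := Metric.dense_iff.1 hR.dense_domain a (ε / 4) (by positivity)
  have h1 : Tendsto (fun i => l i * ‖y‖) F (𝓝 0) := by simpa using h0.mul_const ‖y‖
  filter_upwards [Metric.tendsto_nhds.1 hz (ε / 4) (by positivity),
    h1.eventually (gt_mem_nhds (show 0 < ε / 4 by positivity))] with i hi1 hi2
  rw [dist_eq_norm] at hi1 ⊢
  rw [Metric.mem_ball, dist_eq_norm] at hx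
  have e1 : ‖hR.resolvent (hl i) (z i - a)‖ ≤ ‖z i - a‖ := hR.norm_resolvent_le _ _
  have e2 : ‖hR.resolvent (hl i) (a - x)‖ ≤ ‖x - a‖ :=
    (hR.norm_resolvent_le _ _).trans_eq (norm_sub_rev _ _)
  have e3 : ‖hR.resolvent (hl i) x - x‖ ≤ l i * ‖y‖ := by
    rw [hR.resolvent_eq_add, add_sub_cancel_left, norm_smul, Real.norm_of_nonneg (hl i).le,
      ← hR.resolvent_eq_yosida (hl i) hxy]
    exact mul_le_mul_of_nonneg_left (hR.norm_resolvent_le _ _) (hl i).le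
  have e4 : hR.resolvent (hl i) (z i) - a = hR.resolvent (hl i) (z i - a)
      + hR.resolvent (hl i) (a - x) + (hR.resolvent (hl i) x - x) + (x - a) := by
    simp only [map_sub]; abel
  rw [e4]
  refine (norm_add_le _ _).trans_lt ?_
  have := norm_add₃_le (a := hR.resolvent (hl i) (z i - a)) (b := hR.resolvent (hl i) (a - x))
    (c := hR.resolvent (hl i) x - x)
  linarith

end IsMDissipative

/-! ### Contraction semigroups of bounded generators and their strong limit. -/

theorem hasDerivAt_exp_smul_apply [CompleteSpace X] (A : X →L[ℝ] X) (x : X) (t : ℝ) :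
    HasDerivAt (fun s : ℝ => exp (s • A) x) (A (exp (t • A) x)) t :=
  (hasDerivAt_exp_smul_const' A t).clm_apply (hasDerivAt_const t x) |>.congr_deriv (by simp)

theorem norm_exp_smul_apply_le [CompleteSpace X] {A : X →L[ℝ] X}
    (hA : ∀ z, inner ℝ z (A z) ≤ 0) {t : ℝ} (ht : 0 ≤ t) (x : X) : ‖exp (t • A) x‖ ≤ ‖x‖ := by
  have hd : ∀ s : ℝ, HasDerivAt (fun s : ℝ => ‖exp (s • A) x‖ ^ 2)
      (2 * inner ℝ (exp (s • A) x) (A (exp (s • A) x))) s :=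
    fun s => (hasDerivAt_exp_smul_apply A x s).norm_sq
  have hanti : Antitone (fun s : ℝ => ‖exp (s • A) x‖ ^ 2) :=
    antitone_of_deriv_nonpos (fun s => (hd s).differentiableAt) fun s => by
      rw [(hd s).deriv]
      linarith [hA (exp (s • A) x)]
  refine le_of_sq_le_sq ?_ (norm_nonneg _)
  simpa using hanti ht

/-- Interpolate by s ↦ e^{(t-s)B} e^{sA} x. Commutation puts its derivative in the form e^{(t-s)B}
e^{sA}(Ax - Bx), and both exponentials are contractions. -/
theorem norm_exp_smul_sub_le [CompleteSpace X] {A B : X →L[ℝ] X} (hAB : Commute A B)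
    (hA : ∀ z, inner ℝ z (A z) ≤ 0) (hB : ∀ z, inner ℝ z (B z) ≤ 0) {t : ℝ} (ht : 0 ≤ t) (x : X) :
    ‖exp (t • A) x - exp (t • B) x‖ ≤ ‖A x - B x‖ * t := by
  have hd : ∀ s : ℝ, HasDerivAt (fun s : ℝ => exp ((t - s) • B) (exp (s • A) x))
      (exp ((t - s) • B) (exp (s • A) (A x - B x))) s := by
    intro s
    have h1 : HasDerivAt (fun s : ℝ => exp ((t - s) • B)) (-(exp ((t - s) • B) * B)) s := by
      have h2 := (hasDerivAt_exp_smul_const B (t - s)).scomp s ((hasDerivAt_id s).const_sub t)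
      rw [neg_one_smul] at h2
      exact h2
    refine (h1.clm_apply (hasDerivAt_exp_smul_apply A x s)).congr_deriv ?_
    have c1 : A (exp (s • A) x) = exp (s • A) (A x) :=
      DFunLike.congr_fun (((Commute.refl A).smul_right s).exp_right).eq x
    have c2 : B (exp (s • A) x) = exp (s • A) (B x) :=
      DFunLike.congr_fun ((hAB.symm.smul_right s).exp_right).eq x
    simp [c1, c2, sub_eq_neg_add]
  have := norm_image_sub_le_of_norm_deriv_le_segment' (a := 0) (b := t) (C := ‖A x - B x‖)
    (fun s _ => (hd s).hasDerivWithinAt) (fun s hs =>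
      (norm_exp_smul_apply_le hB (sub_nonneg.2 hs.2.le) _).trans (norm_exp_smul_apply_le hA hs.1 _))
    t (right_mem_Icc.2 ht)
  simpa using this

/-- The Cauchy problem `x' = R x`, `x 0 = x₀` has a mild solution. -/
theorem IsMDissipative.exists_mild_solution [CompleteSpace X] (hR : IsMDissipative R) (x₀ : X) :
    ∃ x : ℝ → X, Continuous x ∧ x 0 = x₀ ∧
      ∀ t, 0 ≤ t → (∫ s in (0 : ℝ)..t, x s, x t - x₀) ∈ R := by
  have hl : ∀ n : ℕ, (0 : ℝ) < 1 / ((n : ℝ) + 1) := fun n => Nat.one_div_pos_of_nat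
  have hl0 : Tendsto (fun n : ℕ => 1 / ((n : ℝ) + 1)) atTop (𝓝 0) :=
    tendsto_one_div_add_atTop_nhds_zero_nat
  let A : ℕ → X →L[ℝ] X := fun n => hR.yosida (hl n)
  have hA : ∀ n z, inner ℝ z (A n z) ≤ 0 := fun n z => hR.inner_yosida_nonpos (hl n) z
  -- The exponentials contract only for nonnegative times; truncating at 0 keeps the approximants
  -- continuous and bounded on all of ℝ.
  have hexp : ∀ n (t : ℝ) z, ‖exp (max t 0 • A n) z‖ ≤ ‖z‖ :=
    fun n t z => norm_exp_smul_apply_le (hA n) (le_max_right _ _) z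
  let y : ℕ → ℝ → X := fun n t => exp (max t 0 • A n) x₀
  have hycont : ∀ n, Continuous (y n) := fun n =>
    (continuous_iff_continuousAt.2 fun t => (hasDerivAt_exp_smul_apply (A n) x₀ t).continuousAt).comp
      (continuous_id.max continuous_const)
  have hcauchy : ∀ T : ℝ, UniformCauchySeqOn y atTop (Iic T) := by
    intro T
    rw [Metric.uniformCauchySeqOn_iff]
    intro ε hε
    obtain ⟨a, ha, b, hab⟩ := Metric.dense_iff.1 hR.dense_domain x₀ (ε / 3) (by positivity)
    rw [Metric.mem_ball, dist_comm, dist_eq_norm] at ha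
    have hc : CauchySeq (fun n => A n a) := by
      have : Tendsto (fun n => A n a) atTop (𝓝 b) := by
        simp only [A, ← hR.resolvent_eq_yosida _ hab]
        exact hR.tendsto_resolvent hl hl0 tendsto_const_nhds
      exact this.cauchySeq
    obtain ⟨N, hN⟩ := Metric.cauchySeq_iff.1 hc (ε / (3 * (max T 0 + 1))) (by positivity)
    refine ⟨N, fun m hm n hn t ht => ?_⟩
    have h1 := hN m hm n hn
    rw [dist_eq_norm, lt_div_iff₀ (by positivity)] at h1
    have h2 := norm_exp_smul_sub_le (hR.yosida_commute (hl m) (hl n)) (hA m) (hA n)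
      (le_max_right t 0) a
    have h3 : ‖A m a - A n a‖ * max t 0 ≤ ‖A m a - A n a‖ * (max T 0 + 1) :=
      mul_le_mul_of_nonneg_left ((max_le_max_right 0 ht).trans (by linarith)) (norm_nonneg _)
    have h4 := hexp m t (x₀ - a)
    have h5 := hexp n t (x₀ - a)
    rw [dist_eq_norm]
    have h6 : y m t - y n t = exp (max t 0 • A m) (x₀ - a)
        + (exp (max t 0 • A m) a - exp (max t 0 • A n) a) - exp (max t 0 • A n) (x₀ - a) := by
      simp only [map_sub, y]; abel
    rw [h6]
    refine (norm_sub_le _ _).trans_lt ?_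
    have h7 := norm_add_le (exp (max t 0 • A m) (x₀ - a))
      (exp (max t 0 • A m) a - exp (max t 0 • A n) a)
    change ‖exp (max t 0 • A m) a - exp (max t 0 • A n) a‖ ≤ ‖A m a - A n a‖ * max t 0 at h2
    linarith
  have hlim : ∀ t, ∃ a, Tendsto (fun n => y n t) atTop (𝓝 a) := fun t =>
    cauchySeq_tendsto_of_complete ((hcauchy t).cauchySeq (mem_Iic.2 le_rfl))
  choose x hx using hlim
  have hunif : ∀ T : ℝ, TendstoUniformlyOn y x atTop (Iic T) := fun T =>
    (hcauchy T).tendstoUniformlyOn_of_tendsto fun t _ => hx t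
  have hxcont : Continuous x := continuous_iff_continuousAt.2 fun t =>
    ((hunif (t + 1)).continuousOn (.of_forall fun n => (hycont n).continuousOn)).continuousAt
      (Iic_mem_nhds (by linarith))
  refine ⟨x, hxcont, ?_, fun t ht => ?_⟩
  · exact tendsto_nhds_unique (hx 0) (by simp [y])
  · have hint : Tendsto (fun n => ∫ s in (0 : ℝ)..t, y n s) atTop (𝓝 (∫ s in (0 : ℝ)..t, x s)) := by
      refine TendstoUniformlyOn.tendsto_intervalIntegral_of_continuousOn
        (.of_forall fun n => (hycont n).continuousOn) ((hunif t).mono ?_)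
      rw [uIcc_of_le ht]
      exact Icc_subset_Iic_self
    -- Each approximant, integrated in time, gives a point of `R`; these points converge, and `R` is
    -- closed.
    have hmem : ∀ n, (hR.resolvent (hl n) (∫ s in (0 : ℝ)..t, y n s), y n t - x₀) ∈ R := by
      intro n
      have h1 : A n (∫ s in (0 : ℝ)..t, y n s) = y n t - x₀ := by
        rw [← (A n).intervalIntegral_comp_comm ((hycont n).intervalIntegrable _ _)]
        have h2 : ∫ s in (0 : ℝ)..t, A n (y n s) =
            ∫ s in (0 : ℝ)..t, A n (exp (s • A n) x₀) := by
          refine intervalIntegral.integral_congr fun s hs => ?_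
          rw [uIcc_of_le ht] at hs
          simp only [y, max_eq_left hs.1]
        rw [h2, intervalIntegral.integral_eq_sub_of_hasDerivAt
          (fun s _ => hasDerivAt_exp_smul_apply (A n) x₀ s)]
        · simp [y, max_eq_left ht]
        · exact Continuous.intervalIntegrable ((A n).continuous.comp
            (continuous_iff_continuousAt.2 fun t =>
              (hasDerivAt_exp_smul_apply (A n) x₀ t).continuousAt)) _ _
      rw [← h1]
      exact hR.resolvent_yosida_mem (hl n) _
    exact hR.isClosed.mem_of_tendsto
      ((hR.tendsto_resolvent hl hl0 hint).prodMk_nhds ((hx t).sub_const x₀)) (.of_forall hmem)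

end HilleYosida

end DampedWave

namespace DampedWave

open Filter Topology

/-! ### Calculus on [0, ∞). -/

section HalfLine

variable {E : Type*} [NormedAddCommGroup E] [NormedSpace ℝ E]

theorem le_of_hasDerivAt_nonpos {f f' : ℝ → ℝ} (hc : ContinuousOn f (Ici 0))
    (hd : ∀ t, 0 < t → HasDerivAt f (f' t) t) (hn : ∀ t, 0 < t → f' t ≤ 0) {t : ℝ} (ht : 0 ≤ t) :
    f t ≤ f 0 := by
  have : AntitoneOn f (Ici 0) := by
    refine antitoneOn_of_deriv_nonpos (convex_Ici 0) hc ?_ ?_ <;> rw [interior_Ici]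
    · exact fun s hs => (hd s hs).differentiableAt.differentiableWithinAt
    · exact fun s hs => (hd s hs).deriv.trans_le (hn s hs)
  exact this self_mem_Ici ht ht

theorem eq_of_hasDerivAt_zero {f : ℝ → ℝ} (hc : ContinuousOn f (Ici 0))
    (hd : ∀ t, 0 < t → HasDerivAt f 0 t) {t : ℝ} (ht : 0 ≤ t) : f t = f 0 := by
  refine le_antisymm (le_of_hasDerivAt_nonpos hc hd (fun _ _ => le_rfl) ht) ?_
  have := le_of_hasDerivAt_nonpos (f := fun s => -f s) (f' := fun _ => 0) hc.neg
    (fun s hs => by simpa using (hd s hs).fun_neg) (fun _ _ => le_rfl) ht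
  linarith

theorem hasDerivAt_primitive [CompleteSpace E] {f : ℝ → E} (hf : Continuous f) (t : ℝ) :
    HasDerivAt (fun s => ∫ r in (0 : ℝ)..s, f r) (f t) t :=
  intervalIntegral.integral_hasDerivAt_right (hf.intervalIntegrable _ _)
    hf.stronglyMeasurable.stronglyMeasurableAtFilter hf.continuousAt

theorem integral_eq_integral_max (f : ℝ → E) {t : ℝ} (ht : 0 ≤ t) :
    ∫ r in (0 : ℝ)..t, f r = ∫ r in (0 : ℝ)..t, f (max r 0) := by
  refine intervalIntegral.integral_congr fun s hs => ?_
  rw [uIcc_of_le ht] at hs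
  simp only [max_eq_left hs.1]

theorem continuous_comp_max {E : Type*} [TopologicalSpace E] {f : ℝ → E} (hf : ContinuousOn f (Ici 0)) :
    Continuous fun r => f (max r 0) :=
  hf.comp_continuous (continuous_id.max continuous_const) fun _ => mem_Ici.2 (le_max_right _ _)

theorem hasDerivAt_primitive_of_continuousOn [CompleteSpace E] {f : ℝ → E}
    (hf : ContinuousOn f (Ici 0)) {t : ℝ} (ht : 0 < t) :
    HasDerivAt (fun s => ∫ r in (0 : ℝ)..s, f r) (f t) t := by
  have h := hasDerivAt_primitive (continuous_comp_max hf) t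
  rw [max_eq_left ht.le] at h
  refine h.congr_of_eventuallyEq ?_
  filter_upwards [lt_mem_nhds ht] with s hs
  exact integral_eq_integral_max f hs.le

theorem continuousOn_primitive_Ici [CompleteSpace E] {f : ℝ → E} (hf : ContinuousOn f (Ici 0)) :
    ContinuousOn (fun s => ∫ r in (0 : ℝ)..s, f r) (Ici 0) := by
  have h : Continuous fun s => ∫ r in (0 : ℝ)..s, f (max r 0) :=
    continuous_iff_continuousAt.2 fun t =>
      (hasDerivAt_primitive (continuous_comp_max hf) t).continuousAt
  exact h.continuousOn.congr fun s hs => integral_eq_integral_max f hs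

end HalfLine

/-! ### The abstract damped wave equation: generator, uniqueness, decay, existence. -/

section Abstract

variable {H K : Type*} [NormedAddCommGroup H] [InnerProductSpace ℝ H]
  [NormedAddCommGroup K] [InnerProductSpace ℝ K]

/-- `Γ` is the graph of a closed, densely defined operator from `H` to `K`. -/
structure IsClosedDenseGraph (Γ : Submodule ℝ (H × K)) : Prop where
  isClosed : IsClosed (Γ : Set (H × K))
  eq_zero_of_zero_mem : ∀ G, ((0 : H), G) ∈ Γ → G = 0
  eq_zero_of_orthogonal : ∀ a : H, (∀ φ Φ, (φ, Φ) ∈ Γ → inner ℝ a φ = 0) → a = 0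

/-- The generator `(v, F) ↦ (-D* F - v, D v)` of the damped wave equation, where `D` is the operator
with graph `Γ`. -/
def waveGenerator (Γ : Submodule ℝ (H × K)) :
    Submodule ℝ (WithLp 2 (H × K) × WithLp 2 (H × K)) where
  carrier := {p | (p.1.fst, p.2.snd) ∈ Γ ∧ ∀ φ Φ, (φ, Φ) ∈ Γ →
    inner ℝ p.2.fst φ = -inner ℝ p.1.snd Φ - inner ℝ p.1.fst φ}
  zero_mem' := ⟨Γ.zero_mem, fun φ Φ _ => by simp⟩
  add_mem' := fun {p q} hp hq => ⟨Γ.add_mem hp.1 hq.1, fun φ Φ h => by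
    have h1 := hp.2 φ Φ h
    have h2 := hq.2 φ Φ h
    simp only [Prod.fst_add, Prod.snd_add, WithLp.add_fst, WithLp.add_snd, inner_add_left, h1, h2]
    ring⟩
  smul_mem' := fun c p hp => ⟨Γ.smul_mem c hp.1, fun φ Φ h => by
    have h1 := hp.2 φ Φ h
    simp only [Prod.smul_fst, Prod.smul_snd, WithLp.smul_fst, WithLp.smul_snd,
      real_inner_smul_left, h1]
    ring⟩

theorem mem_waveGenerator {Γ : Submodule ℝ (H × K)} {x y : WithLp 2 (H × K)} :
    (x, y) ∈ waveGenerator Γ ↔ (x.fst, y.snd) ∈ Γ ∧ ∀ φ Φ, (φ, Φ) ∈ Γ →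
      inner ℝ y.fst φ = -inner ℝ x.snd Φ - inner ℝ x.fst φ :=
  Iff.rfl

/-- The contributions of D and -D* cancel; only the damping term remains. -/
theorem inner_waveGenerator {Γ : Submodule ℝ (H × K)} {x y : WithLp 2 (H × K)}
    (h : (x, y) ∈ waveGenerator Γ) : inner ℝ y x = -‖x.fst‖ ^ 2 := by
  have h1 := (mem_waveGenerator.1 h).2 _ _ (mem_waveGenerator.1 h).1
  have h2 : inner ℝ y x = inner ℝ y.fst x.fst + inner ℝ y.snd x.snd := WithLp.prod_inner_apply _ _
  rw [h2, h1, real_inner_comm x.snd, real_inner_self_eq_norm_sq]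
  ring

/-- Eliminating the second component, the resolvent equation becomes (1+l)⟨v, φ⟩ + l²⟨Dv, Dφ⟩ = ⟨z₁,
φ⟩ - l⟨z₂, Dφ⟩ for all φ. This is the normal equation of an orthogonal projection onto a rescaled
copy of the closed graph. -/
theorem IsClosedDenseGraph.isMDissipative [CompleteSpace H] [CompleteSpace K] 
    {Γ : Submodule ℝ (H × K)} (hΓ : IsClosedDenseGraph Γ) :
    IsMDissipative (waveGenerator Γ) where
  eq_zero_of_zero_mem y hy := by
    obtain ⟨h1, h2⟩ := mem_waveGenerator.1 hy
    have e1 : y.snd = 0 := hΓ.eq_zero_of_zero_mem _ h1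
    have e2 : y.fst = 0 := hΓ.eq_zero_of_orthogonal _ fun φ Φ h => by simpa using h2 φ Φ h
    exact (WithLp.ofLp_injective 2) (Prod.ext e2 e1)
  inner_nonpos x y h := by
    rw [inner_waveGenerator h]
    exact neg_nonpos.2 (sq_nonneg _)
  exists_sub_smul_eq l hl z := by
    have hs : 0 < √(1 + l) := Real.sqrt_pos.2 (by linarith)
    have hs2 : √(1 + l) * √(1 + l) = 1 + l := Real.mul_self_sqrt (by linarith)
    set s := √(1 + l)
    let S : WithLp 2 (H × K) →L[ℝ] H × K :=
      (s⁻¹ • WithLp.fstL 2 ℝ H K).prod (l⁻¹ • WithLp.sndL 2 ℝ H K)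
    let N : Submodule ℝ (WithLp 2 (H × K)) := Γ.comap S.toLinearMap
    have hN : IsClosed (N : Set (WithLp 2 (H × K))) := hΓ.isClosed.preimage S.continuous
    have : CompleteSpace N := hN.completeSpace_coe
    -- The subspace `N` consists of the pairs (sφ, lDφ) with s² = 1 + l, so projecting `q` onto it
    -- yields (sv, lDv).
    let q : WithLp 2 (H × K) := WithLp.toLp 2 (s⁻¹ • z.fst, -z.snd)
    let p := N.starProjection q
    have hp : p ∈ N := N.starProjection_apply_mem q
    have hp' : (s⁻¹ • p.fst, l⁻¹ • p.snd) ∈ Γ := hp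
    have horth : ∀ φ Φ, (φ, Φ) ∈ Γ → inner ℝ (s⁻¹ • z.fst - p.fst) (s • φ)
        + inner ℝ (-z.snd - p.snd) (l • Φ) = 0 := by
      intro φ Φ h
      have hw : WithLp.toLp 2 (s • φ, l • Φ) ∈ N := by
        change (s⁻¹ • s • φ, l⁻¹ • l • Φ) ∈ Γ
        rwa [inv_smul_smul₀ hs.ne', inv_smul_smul₀ hl.ne']
      exact N.starProjection_inner_eq_zero q _ hw
    refine ⟨WithLp.toLp 2 (s⁻¹ • p.fst, z.snd + p.snd),
      WithLp.toLp 2 (l⁻¹ • (s⁻¹ • p.fst - z.fst), l⁻¹ • p.snd), ⟨hp', fun φ Φ h => ?_⟩, ?_⟩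
    · have h1 := horth φ Φ h
      change inner ℝ (l⁻¹ • (s⁻¹ • p.fst - z.fst)) φ
        = -inner ℝ (z.snd + p.snd) Φ - inner ℝ (s⁻¹ • p.fst) φ
      simp only [inner_sub_left, inner_add_left, inner_neg_left, real_inner_smul_left,
        inner_smul_right] at h1 ⊢
      have h2 : inner ℝ p.fst φ * s = (1 + l) * (s⁻¹ * inner ℝ p.fst φ) := by
        rw [← hs2]; field_simp
      have h3 : s * (s⁻¹ * inner ℝ z.fst φ) = inner ℝ z.fst φ := by field_simp
      rw [inv_mul_eq_iff_eq_mul₀ hl.ne']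
      linarith
    · apply WithLp.ofLp_injective 2
      refine Prod.ext ?_ ?_
      · change s⁻¹ • p.fst - l • l⁻¹ • (s⁻¹ • p.fst - z.fst) = z.fst
        rw [smul_inv_smul₀ hl.ne', sub_sub_cancel]
      · change z.snd + p.snd - l • l⁻¹ • p.snd = z.snd
        rw [smul_inv_smul₀ hl.ne', add_sub_cancel_right]

/-- Weak solutions of `u'' + D* D u + u' = 0` where `D` is the operator with graph `Γ`; the curves
`v` and `F` stand for `u'` and `D u`. -/
structure IsGraphSolution (Γ : Submodule ℝ (H × K)) (u v : ℝ → H) (F : ℝ → K) : Prop where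
  mem : ∀ t, 0 ≤ t → (u t, F t) ∈ Γ
  continuousOn_snd : ContinuousOn F (Ici 0)
  hasDerivWithinAt : ∀ t, 0 ≤ t → HasDerivWithinAt u (v t) (Ici 0) t
  continuousOn_deriv : ContinuousOn v (Ici 0)
  equation : ∀ φ Φ, (φ, Φ) ∈ Γ → ∀ t, 0 < t →
    HasDerivAt (fun s => inner ℝ (v s) φ) (-(inner ℝ (F t) Φ + inner ℝ (v t) φ)) t

namespace IsGraphSolution

variable {Γ : Submodule ℝ (H × K)} {u v : ℝ → H} {F : ℝ → K}

theorem continuousOn (h : IsGraphSolution Γ u v F) : ContinuousOn u (Ici 0) :=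
  fun t ht => (h.hasDerivWithinAt t ht).continuousWithinAt

theorem hasDerivAt (h : IsGraphSolution Γ u v F) {t : ℝ} (ht : 0 < t) : HasDerivAt u (v t) t :=
  (h.hasDerivWithinAt t ht.le).hasDerivAt (Ici_mem_nhds ht)

/-- The equation integrated in time. -/
theorem inner_add_sub_eq [CompleteSpace K] (h : IsGraphSolution Γ u v F) {φ : H}
    {Φ : K} (hφ : (φ, Φ) ∈ Γ) {t : ℝ} (ht : 0 ≤ t) : inner ℝ (v t) φ + inner ℝ (u t) φ - inner ℝ (u 0 + v 0) φ
      = -inner ℝ (∫ s in (0 : ℝ)..t, F s) Φ := by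
  have hc : ContinuousOn (fun t => inner ℝ (v t) φ + inner ℝ (u t) φ
      + inner ℝ (∫ s in (0 : ℝ)..t, F s) Φ) (Ici 0) :=
    ((h.continuousOn_deriv.inner continuousOn_const).add
      (h.continuousOn.inner continuousOn_const)).add
      ((continuousOn_primitive_Ici h.continuousOn_snd).inner continuousOn_const)
  have hd : ∀ t, 0 < t → HasDerivAt (fun t => inner ℝ (v t) φ + inner ℝ (u t) φ
      + inner ℝ (∫ s in (0 : ℝ)..t, F s) Φ) 0 t := by
    intro t ht
    refine (((h.equation φ Φ hφ t ht).add ((h.hasDerivAt ht).inner ℝ (hasDerivAt_const t φ))).add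
      ((hasDerivAt_primitive_of_continuousOn h.continuousOn_snd ht).inner ℝ
        (hasDerivAt_const t Φ))).congr_deriv ?_
    simp only [inner_zero_right]
    ring
  have := eq_of_hasDerivAt_zero hc hd ht
  simp only [intervalIntegral.integral_same, inner_zero_left] at this
  rw [inner_add_left]
  linarith

/-- The multiplier identity obtained from the time integrated equation. -/
theorem hasDerivAt_integrated_energy [CompleteSpace H] [CompleteSpace K] 
    (h : IsGraphSolution Γ u v F) {t : ℝ} (ht : 0 < t) :
    HasDerivAt (fun t => 1 / 2 * (‖u t‖ ^ 2 + ‖∫ s in (0 : ℝ)..t, F s‖ ^ 2)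
      - inner ℝ (u 0 + v 0) (∫ s in (0 : ℝ)..t, u s)) (-‖u t‖ ^ 2) t := by
  have h1 := h.inner_add_sub_eq (h.mem t ht.le) ht.le
  refine ((((h.hasDerivAt ht).norm_sq.add
    (hasDerivAt_primitive_of_continuousOn h.continuousOn_snd ht).norm_sq).const_mul (1 / 2)).sub
    ((hasDerivAt_const t (u 0 + v 0)).inner ℝ
      (hasDerivAt_primitive_of_continuousOn h.continuousOn ht))).congr_deriv ?_
  rw [real_inner_self_eq_norm_sq, real_inner_comm (u t) (v t)] at h1
  simp only [inner_zero_left]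
  linarith

/-- The multiplier identity obtained by testing the equation with the solution. -/
theorem hasDerivAt_inner_add (h : IsGraphSolution Γ u v F) {t : ℝ} (ht : 0 < t) :
    HasDerivAt (fun t => inner ℝ (v t) (u t) + 1 / 2 * ‖u t‖ ^ 2) (‖v t‖ ^ 2 - ‖F t‖ ^ 2) t := by
  -- The curve `v` is differentiable only against elements of the domain. Freezing one factor at `u
  -- t` leaves this remainder, which needs only continuity of `v` and differentiability of `u`.
  have h1 : HasDerivAt (fun s => inner ℝ (v s) (u s - u t)) (‖v t‖ ^ 2) t := by
    have hs : Tendsto (slope u t) (𝓝[≠] t) (𝓝 (v t)) := (h.hasDerivAt ht).tendsto_slope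
    have hv : Tendsto v (𝓝[≠] t) (𝓝 (v t)) :=
      (h.continuousOn_deriv.continuousAt (Ici_mem_nhds ht)).tendsto.mono_left nhdsWithin_le_nhds
    rw [hasDerivAt_iff_tendsto_slope, ← real_inner_self_eq_norm_sq]
    refine (hv.inner hs).congr fun s => ?_
    simp [slope_def_module, inner_smul_right]
  have h2 := h.equation (u t) (F t) (h.mem t ht.le) t ht
  refine ((h1.add h2).add ((h.hasDerivAt ht).norm_sq.const_mul (1 / 2))).congr_deriv ?_
    |>.congr_of_eventuallyEq (.of_forall fun s => ?_)
  · rw [real_inner_self_eq_norm_sq, real_inner_comm (u t) (v t)]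
    ring
  · simp only [Pi.add_apply, inner_sub_right]
    ring

theorem sub (h : IsGraphSolution Γ u v F) {u' v' : ℝ → H} {F' : ℝ → K}
    (h' : IsGraphSolution Γ u' v' F') : IsGraphSolution Γ (u - u') (v - v') (F - F') where
  mem t ht := Γ.sub_mem (h.mem t ht) (h'.mem t ht)
  continuousOn_snd := h.continuousOn_snd.sub h'.continuousOn_snd
  hasDerivWithinAt t ht := (h.hasDerivWithinAt t ht).sub (h'.hasDerivWithinAt t ht)
  continuousOn_deriv := h.continuousOn_deriv.sub h'.continuousOn_deriv
  equation φ Φ hφ t ht := by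
    have := (h.equation φ Φ hφ t ht).sub (h'.equation φ Φ hφ t ht)
    refine (this.congr_of_eventuallyEq (.of_forall fun s => ?_)).congr_deriv ?_
    · simp [inner_sub_left]
    · simp only [Pi.sub_apply, inner_sub_left]
      ring

/-- With zero data the linear term of the time-integrated identity disappears, leaving ½(‖u‖² +
‖∫F‖²) nonincreasing from 0. The energy identity, which is not available for general weak solutions,
is avoided. -/
theorem eq_zero [CompleteSpace H] [CompleteSpace K] (hΓ : IsClosedDenseGraph Γ)
    (h : IsGraphSolution Γ u v F) (hu : u 0 = 0) (hv : v 0 = 0) {t : ℝ} (ht : 0 ≤ t) : u t = 0 ∧ v t = 0 ∧ F t = 0 := by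
  have hz : ∀ t, 0 ≤ t → u t = 0 := by
    intro t ht
    have hc : ContinuousOn (fun t => 1 / 2 * (‖u t‖ ^ 2 + ‖∫ s in (0 : ℝ)..t, F s‖ ^ 2)
        - inner ℝ (u 0 + v 0) (∫ s in (0 : ℝ)..t, u s)) (Ici 0) :=
      (((h.continuousOn.norm.pow 2).add
        ((continuousOn_primitive_Ici h.continuousOn_snd).norm.pow 2)).const_mul _).sub
        (continuousOn_const.inner (continuousOn_primitive_Ici h.continuousOn))
    have := le_of_hasDerivAt_nonpos hc (fun s hs => h.hasDerivAt_integrated_energy hs)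
      (fun s _ => neg_nonpos.2 (sq_nonneg _)) ht
    simp only [hu, hv, intervalIntegral.integral_same, norm_zero, add_zero, inner_zero_left] at this
    have h0 : ‖u t‖ ^ 2 ≤ 0 := by nlinarith [sq_nonneg ‖∫ s in (0 : ℝ)..t, F s‖]
    exact norm_eq_zero.1 (pow_eq_zero_iff two_ne_zero |>.1 (le_antisymm h0 (sq_nonneg _)))
  refine ⟨hz t ht, ?_, ?_⟩
  · have h1 := h.hasDerivWithinAt t ht
    have h2 : HasDerivWithinAt u 0 (Ici 0) t :=
      (hasDerivWithinAt_const t (Ici 0) (0 : H)).congr (fun s hs => hz s hs) (hz t ht)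
    exact (uniqueDiffOn_Ici (0 : ℝ) t ht).eq_deriv _ h1 h2
  · have h1 := h.mem t ht
    rw [hz t ht] at h1
    exact hΓ.eq_zero_of_zero_mem _ h1

theorem unique [CompleteSpace H] [CompleteSpace K] (hΓ : IsClosedDenseGraph Γ)
    (h : IsGraphSolution Γ u v F) {u' v' : ℝ → H} {F' : ℝ → K} (h' : IsGraphSolution Γ u' v' F') (hu : u 0 = u' 0) (hv : v 0 = v' 0) {t : ℝ}
    (ht : 0 ≤ t) : u t = u' t ∧ v t = v' t ∧ F t = F' t := by
  have := (h.sub h').eq_zero hΓ (by simp [hu]) (by simp [hv]) ht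
  simpa only [Pi.sub_apply, sub_eq_zero] using this

/-- Decay of the energy, for solutions that satisfy the energy identity. -/
theorem decay_of_energy_identity [CompleteSpace H] [CompleteSpace K] 
    (h : IsGraphSolution Γ u v F)
    (hE : ∀ t, 0 < t → HasDerivAt (fun s => 1 / 2 * (‖v s‖ ^ 2 + ‖F s‖ ^ 2)) (-‖v t‖ ^ 2) t)
    {t : ℝ} (ht : 0 ≤ t) :
    (1 + t) ^ 2 * (1 / 2 * (‖v t‖ ^ 2 + ‖F t‖ ^ 2)) + 1 / 4 * (1 + t) * ‖u t‖ ^ 2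
      + (1 / 2 * ‖∫ s in (0 : ℝ)..t, F s‖ ^ 2 - inner ℝ (u 0 + v 0) (∫ s in (0 : ℝ)..t, u s))
      ≤ 3 * (‖v 0‖ ^ 2 + ‖F 0‖ ^ 2) + 2 * inner ℝ (v 0) (u 0) + 3 / 2 * ‖u 0‖ ^ 2 := by
  let E : ℝ → ℝ := fun s => 1 / 2 * (‖v s‖ ^ 2 + ‖F s‖ ^ 2)
  let Y : ℝ → ℝ := fun s => inner ℝ (v s) (u s) + 1 / 2 * ‖u s‖ ^ 2
  let Z : ℝ → ℝ := fun s => 1 / 2 * (‖u s‖ ^ 2 + ‖∫ r in (0 : ℝ)..s, F r‖ ^ 2)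
      - inner ℝ (u 0 + v 0) (∫ r in (0 : ℝ)..s, u r)
  have hEc : ContinuousOn E (Ici 0) :=
    ((h.continuousOn_deriv.norm.pow 2).add (h.continuousOn_snd.norm.pow 2)).const_mul _
  have hYc : ContinuousOn Y (Ici 0) :=
    (h.continuousOn_deriv.inner h.continuousOn).add ((h.continuousOn.norm.pow 2).const_mul _)
  have hZc : ContinuousOn Z (Ici 0) :=
    (((h.continuousOn.norm.pow 2).add
      ((continuousOn_primitive_Ici h.continuousOn_snd).norm.pow 2)).const_mul _).sub
      (continuousOn_const.inner (continuousOn_primitive_Ici h.continuousOn))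
  have hlin : ContinuousOn (fun s : ℝ => 1 + s) (Ici 0) := by fun_prop
  have hc : ContinuousOn (fun s => (1 + s) ^ 2 * E s + (1 + s) * (Y s + 2 * E s) + Y s + 3 * E s
      + Z s) (Ici 0) :=
    (((((hlin.pow 2).mul hEc).add (hlin.mul (hYc.add (hEc.const_mul 2)))).add hYc).add
      (hEc.const_mul 3)).add hZc
  have hd : ∀ s, 0 < s → HasDerivAt (fun s => (1 + s) ^ 2 * E s + (1 + s) * (Y s + 2 * E s) + Y s
      + 3 * E s + Z s)
      (2 * (1 + s) * E s + (1 + s) ^ 2 * (-‖v s‖ ^ 2) + ((Y s + 2 * E s)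
        + (1 + s) * (‖v s‖ ^ 2 - ‖F s‖ ^ 2 + 2 * (-‖v s‖ ^ 2))) + (‖v s‖ ^ 2 - ‖F s‖ ^ 2)
        + 3 * (-‖v s‖ ^ 2) + -‖u s‖ ^ 2) s := by
    intro s hs
    have hl : HasDerivAt (fun s : ℝ => 1 + s) 1 s := (hasDerivAt_id s).const_add 1
    have hl2 : HasDerivAt (fun s : ℝ => (1 + s) ^ 2) (2 * (1 + s)) s := by
      simpa using hl.fun_pow 2
    have h1 := hE s hs
    have h2 := h.hasDerivAt_inner_add hs
    have h3 := h.hasDerivAt_integrated_energy hs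
    refine (((((hl2.mul h1).add (hl.mul (h2.add (h1.const_mul 2)))).add h2).add
      (h1.const_mul 3)).add h3).congr_deriv ?_
    simp only [E, Y, Pi.add_apply]
    ring
  have hY1 : ∀ s, inner ℝ (v s) (u s) ≤ 1 / 2 * ‖v s‖ ^ 2 + 1 / 2 * ‖u s‖ ^ 2 := fun s => by
    nlinarith [real_inner_le_norm (v s) (u s), sq_nonneg (‖v s‖ - ‖u s‖)]
  -- The weights make the terms with factor 1 + s cancel, as well as all the ‖F‖² terms. What
  -- remains is ⟨v, u⟩ - ½‖u‖² - ‖v‖² - (1+s)²‖v‖².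
  have hn : ∀ s, 0 < s → 2 * (1 + s) * E s + (1 + s) ^ 2 * (-‖v s‖ ^ 2) + ((Y s + 2 * E s)
        + (1 + s) * (‖v s‖ ^ 2 - ‖F s‖ ^ 2 + 2 * (-‖v s‖ ^ 2))) + (‖v s‖ ^ 2 - ‖F s‖ ^ 2)
        + 3 * (-‖v s‖ ^ 2) + -‖u s‖ ^ 2 ≤ 0 := by
    intro s hs
    have := hY1 s
    simp only [E, Y]
    have h4 : 0 ≤ (1 + s) ^ 2 * ‖v s‖ ^ 2 := by positivity
    nlinarith [sq_nonneg ‖v s‖]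
  have hmain := le_of_hasDerivAt_nonpos hc hd hn ht
  -- This splitting leaves ¼‖u‖² of the ½‖u‖² in Y + 2E, the source of the bound for (1+t)‖u‖².
  have hY2 : -‖v t‖ ^ 2 - 1 / 4 * ‖u t‖ ^ 2 ≤ inner ℝ (v t) (u t) := by
    have := neg_abs_le (inner ℝ (v t) (u t))
    nlinarith [abs_real_inner_le_norm (v t) (u t), sq_nonneg (‖v t‖ - 1 / 2 * ‖u t‖)]
  have h5 : 0 ≤ (1 + t) * (inner ℝ (v t) (u t) + ‖v t‖ ^ 2 + 1 / 4 * ‖u t‖ ^ 2) :=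
    mul_nonneg (by linarith) (by linarith)
  have h6 : 0 ≤ (1 + t) * ‖F t‖ ^ 2 := by positivity
  simp only [E, Y, Z, intervalIntegral.integral_same, norm_zero, inner_zero_right] at hmain
  nlinarith [sq_nonneg ‖v t‖, sq_nonneg ‖F t‖, sq_nonneg ‖u t‖]

end IsGraphSolution

theorem intervalIntegral_fst [CompleteSpace H] [CompleteSpace K] {x : ℝ → WithLp 2 (H × K)}
    (hx : Continuous x) (a b : ℝ) : (∫ s in a..b, x s).fst = ∫ s in a..b, (x s).fst :=
  ((WithLp.fstL 2 ℝ H K).intervalIntegral_comp_comm (hx.intervalIntegrable a b)).symm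

theorem intervalIntegral_snd [CompleteSpace H] [CompleteSpace K] {x : ℝ → WithLp 2 (H × K)}
    (hx : Continuous x) (a b : ℝ) : (∫ s in a..b, x s).snd = ∫ s in a..b, (x s).snd :=
  ((WithLp.sndL 2 ℝ H K).intervalIntegral_comp_comm (hx.intervalIntegrable a b)).symm

/-- Existence of weak solutions of the abstract damped wave equation, with decay. -/
theorem IsClosedDenseGraph.exists_solution [CompleteSpace H] [CompleteSpace K]
    {Γ : Submodule ℝ (H × K)} (hΓ : IsClosedDenseGraph Γ) {u₀ u₁ : H} {F₀ : K}
    (h₀ : (u₀, F₀) ∈ Γ) :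
    ∃ (u v : ℝ → H) (F : ℝ → K), IsGraphSolution Γ u v F ∧ u 0 = u₀ ∧ v 0 = u₁ ∧
      ∀ t, 0 ≤ t →
        (1 + t) ^ 2 * (1 / 2 * (‖v t‖ ^ 2 + ‖F t‖ ^ 2)) + 1 / 4 * (1 + t) * ‖u t‖ ^ 2
          + (1 / 2 * ‖∫ s in (0 : ℝ)..t, F s‖ ^ 2 - inner ℝ (u₀ + u₁) (∫ s in (0 : ℝ)..t, u s))
          ≤ 3 * (‖u₁‖ ^ 2 + ‖F₀‖ ^ 2) + 2 * inner ℝ u₁ u₀ + 3 / 2 * ‖u₀‖ ^ 2 := by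
  have hR := hΓ.isMDissipative
  obtain ⟨x, hx, hx0, hmild⟩ := hR.exists_mild_solution (WithLp.toLp 2 (u₁, F₀))
  have hv : Continuous fun t => (x t).fst := (WithLp.fstL 2 ℝ H K).continuous.comp hx
  have hF : Continuous fun t => (x t).snd := (WithLp.sndL 2 ℝ H K).continuous.comp hx
  have hv0 : (x 0).fst = u₁ := by rw [hx0]; rfl
  have hF0 : (x 0).snd = F₀ := by rw [hx0]; rfl
  let u : ℝ → H := fun t => u₀ + ∫ s in (0 : ℝ)..t, (x s).fst
  have hu : ∀ t, HasDerivAt u (x t).fst t := fun t => (hasDerivAt_primitive hv t).const_add u₀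
  have hu0 : u 0 = u₀ := by simp [u]
  have hmem : ∀ t, 0 ≤ t → (u t, (x t).snd) ∈ Γ := by
    intro t ht
    have h1 := (mem_waveGenerator.1 (hmild t ht)).1
    rw [intervalIntegral_fst hx] at h1
    have h2 := Γ.add_mem h₀ h1
    have h3 : F₀ + (x t - WithLp.toLp 2 (u₁, F₀)).snd = (x t).snd := by
      change F₀ + ((x t).snd - F₀) = _
      abel
    rw [Prod.mk_add_mk, h3] at h2
    exact h2
  have hsol : IsGraphSolution Γ u (fun t => (x t).fst) (fun t => (x t).snd) := by
    refine ⟨hmem, hF.continuousOn, fun t _ => (hu t).hasDerivWithinAt, hv.continuousOn,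
      fun φ Φ hφ t ht => ?_⟩
    have h1 := ((hasDerivAt_const t (inner ℝ u₁ φ)).sub
      ((hasDerivAt_primitive hF t).inner ℝ (hasDerivAt_const t Φ))).sub
      ((hasDerivAt_primitive hv t).inner ℝ (hasDerivAt_const t φ))
    refine (h1.congr_of_eventuallyEq ?_).congr_deriv ?_
    · filter_upwards [lt_mem_nhds ht] with s hs
      have h2 := (mem_waveGenerator.1 (hmild s hs.le)).2 φ Φ hφ
      rw [intervalIntegral_fst hx, intervalIntegral_snd hx] at h2
      change inner ℝ ((x s).fst - u₁) φ = _ at h2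
      rw [inner_sub_left] at h2
      simp only [Pi.sub_apply]
      linarith
    · simp only [inner_zero_right]
      ring
  refine ⟨u, _, _, hsol, hu0, hv0, fun t ht => ?_⟩
  have hl : ∀ n : ℕ, (0 : ℝ) < 1 / ((n : ℝ) + 1) := fun n => Nat.one_div_pos_of_nat
  have hl0 : Tendsto (fun n : ℕ => 1 / ((n : ℝ) + 1)) atTop (𝓝 0) :=
    tendsto_one_div_add_atTop_nhds_zero_nat
  let J : ℕ → WithLp 2 (H × K) →L[ℝ] WithLp 2 (H × K) := fun n => hR.resolvent (hl n)
  let A : ℕ → WithLp 2 (H × K) →L[ℝ] WithLp 2 (H × K) := fun n => hR.yosida (hl n)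
  -- the resolvents map the mild solution to strong solutions
  let y : ℕ → ℝ → WithLp 2 (H × K) := fun n s => J n (x 0) + A n (∫ r in (0 : ℝ)..s, x r)
  have hy : ∀ n s, 0 ≤ s → y n s = J n (x s) := by
    intro n s hs
    have h1 := hR.resolvent_eq_yosida (hl n) (hmild s hs)
    rw [← hx0, map_sub] at h1
    simp only [y, J, A, ← h1]
    abel
  -- Since `x` is merely continuous, the derivative is read off the time-integrated form.
  have hyd : ∀ n s, HasDerivAt (y n) (A n (x s)) s := fun n s =>
    ((A n).hasFDerivAt.comp_hasDerivAt s (hasDerivAt_primitive hx s)).const_add _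
  have hyc : ∀ n, Continuous (y n) := fun n =>
    continuous_iff_continuousAt.2 fun s => (hyd n s).continuousAt
  have hJA : ∀ n s, 0 ≤ s → (y n s, A n (x s)) ∈ waveGenerator Γ := fun n s hs => by
    rw [hy n s hs]
    exact hR.resolvent_yosida_mem (hl n) (x s)
  have hyx : ∀ n s, 0 ≤ s → y n s = x s + (1 / ((n : ℝ) + 1)) • A n (x s) := fun n s hs => by
    rw [hy n s hs]
    exact hR.resolvent_eq_add (hl n) (x s)
  have hyd1 : ∀ n s, HasDerivAt (fun r => (y n r).fst) (A n (x s)).fst s := fun n s =>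
    (WithLp.fstL 2 ℝ H K).hasFDerivAt.comp_hasDerivAt s (hyd n s)
  have hyc1 : ∀ n, Continuous fun s => (y n s).fst := fun n =>
    (WithLp.fstL 2 ℝ H K).continuous.comp (hyc n)
  have hyc2 : ∀ n, Continuous fun s => (y n s).snd := fun n =>
    (WithLp.sndL 2 ℝ H K).continuous.comp (hyc n)
  -- This correction is the one for which both u_n' and D u_n are the components of y_n = x + l A_n
  -- x.
  let un : ℕ → ℝ → H := fun n s => u s + (1 / ((n : ℝ) + 1)) • (y n s).fst
  have hstrong : ∀ n, IsGraphSolution Γ (un n) (fun s => (y n s).fst) (fun s => (y n s).snd) := by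
    intro n
    refine ⟨fun s hs => ?_, (hyc2 n).continuousOn, fun s hs => ?_, (hyc1 n).continuousOn,
      fun φ Φ hφ s hs => ?_⟩
    · have h1 := (mem_waveGenerator.1 (hJA n s hs)).1
      have h2 := Γ.add_mem (hmem s hs) (Γ.smul_mem (1 / ((n : ℝ) + 1)) h1)
      have h3 : (y n s).snd = (x s).snd + (1 / ((n : ℝ) + 1)) • (A n (x s)).snd := by
        rw [hyx n s hs]; rfl
      rw [h3]
      exact h2
    · refine (((hu s).add ((hyd1 n s).const_smul (1 / ((n : ℝ) + 1)))).congr_deriv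
        ?_).hasDerivWithinAt
      rw [hyx n s hs]; rfl
    · refine ((hyd1 n s).inner ℝ (hasDerivAt_const s φ)).congr_deriv ?_
      rw [inner_zero_right, (mem_waveGenerator.1 (hJA n s hs.le)).2 φ Φ hφ]
      ring
  have henergy : ∀ n s, 0 < s → HasDerivAt
      (fun r => 1 / 2 * (‖(y n r).fst‖ ^ 2 + ‖(y n r).snd‖ ^ 2)) (-‖(y n s).fst‖ ^ 2) s := by
    intro n s hs
    have h1 := (hyd n s).norm_sq.const_mul (1 / 2)
    rw [real_inner_comm, inner_waveGenerator (hJA n s hs.le)] at h1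
    refine (h1.congr_of_eventuallyEq (.of_forall fun r => ?_)).congr_deriv (by ring)
    simp only [WithLp.prod_norm_sq_eq_of_L2]
  have hest := fun n => (hstrong n).decay_of_energy_identity (henergy n) ht
  have hJx : ∀ s, 0 ≤ s → Tendsto (fun n => y n s) atTop (𝓝 (x s)) := fun s hs => by
    simp only [hy _ s hs]
    exact hR.tendsto_resolvent hl hl0 tendsto_const_nhds
  have hfst : ∀ s, 0 ≤ s → Tendsto (fun n => (y n s).fst) atTop (𝓝 (x s).fst) := fun s hs =>
    ((WithLp.fstL 2 ℝ H K).continuous.tendsto _).comp (hJx s hs)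
  have hsnd : ∀ s, 0 ≤ s → Tendsto (fun n => (y n s).snd) atTop (𝓝 (x s).snd) := fun s hs =>
    ((WithLp.sndL 2 ℝ H K).continuous.tendsto _).comp (hJx s hs)
  have hun : ∀ s, 0 ≤ s → Tendsto (fun n => un n s) atTop (𝓝 (u s)) := fun s hs => by
    simpa [un] using (hl0.smul (hfst s hs)).const_add (u s)
  have hyint : Tendsto (fun n => ∫ s in (0 : ℝ)..t, y n s) atTop
      (𝓝 (∫ s in (0 : ℝ)..t, x s)) := by
    have h1 : ∀ n, ∫ s in (0 : ℝ)..t, y n s = J n (∫ s in (0 : ℝ)..t, x s) := fun n => by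
      rw [← (J n).intervalIntegral_comp_comm (hx.intervalIntegrable _ _)]
      refine intervalIntegral.integral_congr fun s hs => ?_
      rw [uIcc_of_le ht] at hs
      exact hy n s hs.1
    simp only [h1]
    exact hR.tendsto_resolvent hl hl0 tendsto_const_nhds
  have hWint : Tendsto (fun n => ∫ s in (0 : ℝ)..t, (y n s).snd) atTop
      (𝓝 (∫ s in (0 : ℝ)..t, (x s).snd)) := by
    simp only [← intervalIntegral_snd (hyc _), ← intervalIntegral_snd hx]
    exact ((WithLp.sndL 2 ℝ H K).continuous.tendsto _).comp hyint
  have hwint : Tendsto (fun n => ∫ s in (0 : ℝ)..t, un n s) atTop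
      (𝓝 (∫ s in (0 : ℝ)..t, u s)) := by
    have huc : Continuous u := continuous_iff_continuousAt.2 fun s => (hu s).continuousAt
    have h1 : ∀ n, ∫ s in (0 : ℝ)..t, un n s = (∫ s in (0 : ℝ)..t, u s)
        + (1 / ((n : ℝ) + 1)) • (∫ s in (0 : ℝ)..t, y n s).fst := fun n => by
      rw [intervalIntegral_fst (hyc n), ← intervalIntegral.integral_smul]
      exact intervalIntegral.integral_add (huc.intervalIntegrable _ _)
        (((hyc1 n).const_smul _).intervalIntegrable _ _)
    simp only [h1]
    simpa using (hl0.smul (((WithLp.fstL 2 ℝ H K).continuous.tendsto _).comp hyint)).const_add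
      (∫ s in (0 : ℝ)..t, u s)
  have hlim := le_of_tendsto_of_tendsto'
    (((((((hfst t ht).norm.pow 2).add ((hsnd t ht).norm.pow 2)).const_mul (1 / 2)).const_mul
      ((1 + t) ^ 2)).add (((hun t ht).norm.pow 2).const_mul (1 / 4 * (1 + t)))).add
      (((hWint.norm.pow 2).const_mul (1 / 2)).sub
        (((hun 0 le_rfl).add (hfst 0 le_rfl)).inner hwint)))
    ((((((hfst 0 le_rfl).norm.pow 2).add ((hsnd 0 le_rfl).norm.pow 2)).const_mul 3).add
      (((hfst 0 le_rfl).inner (hun 0 le_rfl)).const_mul 2)).add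
      (((hun 0 le_rfl).norm.pow 2).const_mul (3 / 2))) hest
  rw [hv0, hF0, hu0] at hlim
  exact hlim

end Abstract

end DampedWave

namespace DampedWave

open Filter Topology

/-! ### Realization in L²(ℝⁿ): weak gradients, the potential, and the weighted duality. -/

section Concrete

variable {n : ℕ}

theorem L2.inner_eq_integral (f g : L2 n) : inner ℝ f g = ∫ x, f x * g x := by
  rw [MeasureTheory.L2.inner_def]
  exact integral_congr_ae (.of_forall fun x => mul_comm _ _)

theorem memLp_sqrt (V : Space n →ᵇ ℝ) :
    MemLp (fun x => √(V x)) ⊤ (volume : Measure (Space n)) := by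
  refine memLp_top_of_bound V.continuous.sqrt.aestronglyMeasurable (√‖V‖) (.of_forall fun x => ?_)
  rw [Real.norm_of_nonneg (Real.sqrt_nonneg _)]
  exact Real.sqrt_le_sqrt ((le_abs_self _).trans (V.norm_coe_le_norm x))

/-- Multiplication by `√V` on `L²(ℝⁿ)`. -/
def sqrtMul (V : Space n →ᵇ ℝ) : L2 n →L[ℝ] L2 n :=
  (ContinuousLinearMap.mul ℝ ℝ).holderL volume ⊤ 2 2 (memLp_sqrt V).toLp

theorem sqrtMul_ae (V : Space n →ᵇ ℝ) (f : L2 n) :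
    sqrtMul V f =ᵐ[volume] fun x => √(V x) * f x := by
  have h1 : sqrtMul V f =ᵐ[volume] fun x => (memLp_sqrt V).toLp _ x * f x :=
    (ContinuousLinearMap.mul ℝ ℝ).coeFn_holder (r := 2) (memLp_sqrt V).toLp f
  filter_upwards [h1, (memLp_sqrt V).coeFn_toLp] with x h2 h3
  rw [h2, h3]

theorem inner_sqrtMul {V : Space n →ᵇ ℝ} (hV : ∀ x, 0 < V x) (f g : L2 n) :
    inner ℝ (sqrtMul V f) (sqrtMul V g) = ∫ x, V x * f x * g x := by
  rw [L2.inner_eq_integral]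
  refine integral_congr_ae ?_
  filter_upwards [sqrtMul_ae V f, sqrtMul_ae V g] with x h1 h2
  rw [h1, h2]
  nth_rw 3 [← Real.mul_self_sqrt (hV x).le]
  ring

theorem integrable_mul_sq {V : Space n →ᵇ ℝ} (hV : ∀ x, 0 < V x) (f : L2 n) :
    Integrable (fun x => V x * |f x| ^ 2) := by
  refine (L2.integrable_inner (𝕜 := ℝ) (sqrtMul V f) (sqrtMul V f)).congr ?_
  filter_upwards [sqrtMul_ae V f] with x h1
  rw [h1, real_inner_self_eq_norm_sq, Real.norm_eq_abs, sq_abs, sq_abs, mul_pow,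
    Real.sq_sqrt (hV x).le]

theorem integrable_norm_sq {E : Type*} [NormedAddCommGroup E] [InnerProductSpace ℝ E]
    (f : Lp E 2 (volume : Measure (Space n))) : Integrable (fun x => ‖f x‖ ^ 2) := by
  refine (L2.integrable_inner (𝕜 := ℝ) f f).congr (.of_forall fun x => ?_)
  exact real_inner_self_eq_norm_sq _

theorem integral_norm_sq {E : Type*} [NormedAddCommGroup E] [InnerProductSpace ℝ E]
    (f : Lp E 2 (volume : Measure (Space n))) : ∫ x, ‖f x‖ ^ 2 = ‖f‖ ^ 2 := by
  rw [← real_inner_self_eq_norm_sq, MeasureTheory.L2.inner_def]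
  exact integral_congr_ae (.of_forall fun x => (real_inner_self_eq_norm_sq _).symm)

theorem integral_mul_sq {V : Space n →ᵇ ℝ} (hV : ∀ x, 0 < V x) (f : L2 n) :
    ∫ x, V x * |f x| ^ 2 = ‖sqrtMul V f‖ ^ 2 := by
  rw [← real_inner_self_eq_norm_sq, inner_sqrtMul hV]
  exact integral_congr_ae (.of_forall fun x => by simp only [sq_abs]; ring)

theorem energy_eq {V : Space n →ᵇ ℝ} (hV : ∀ x, 0 < V x) (f g : L2 n) (G : L2Vec n) :
    energy V f g G = 1 / 2 * (‖g‖ ^ 2 + (‖G‖ ^ 2 + ‖sqrtMul V f‖ ^ 2)) := by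
  have h1 : Integrable (fun x => |g x| ^ 2) := integrable_norm_sq g
  have h2 : ∫ x, |g x| ^ 2 = ‖g‖ ^ 2 := integral_norm_sq g
  rw [energy, integral_add (h1.fun_add (integrable_norm_sq G)) (integrable_mul_sq hV f),
    integral_add h1 (integrable_norm_sq G), h2, integral_norm_sq, integral_mul_sq hV, add_assoc]

/-- The pairings with a test function in the definition of the weak gradient are continuous. -/
theorem exists_inner_test {φ : Space n → ℝ} (hφ : ContDiff ℝ ∞ φ) (hc : HasCompactSupport φ)
    (i : Fin n) : ∃ (a : L2 n) (b : L2Vec n),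
      (∀ f : L2 n, ∫ x, f x * fderiv ℝ φ x (EuclideanSpace.single i 1) = inner ℝ f a) ∧
      ∀ G : L2Vec n, ∫ x, G x i * φ x = inner ℝ G b := by
  have ha : MemLp (fun x => fderiv ℝ φ x (EuclideanSpace.single i 1)) 2
      (volume : Measure (Space n)) :=
    ((hφ.continuous_fderiv (by simp)).clm_apply continuous_const).memLp_of_hasCompactSupport
      (hc.fderiv_apply ℝ _)
  have hb : MemLp (fun x => φ x • (EuclideanSpace.single i 1 : Space n)) 2
      (volume : Measure (Space n)) :=
    (hφ.continuous.smul continuous_const).memLp_of_hasCompactSupport hc.smul_right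
  refine ⟨ha.toLp, hb.toLp, fun f => ?_, fun G => ?_⟩
  · rw [L2.inner_eq_integral]
    refine integral_congr_ae ?_
    filter_upwards [ha.coeFn_toLp] with x hx
    rw [hx]
  · rw [MeasureTheory.L2.inner_def]
    refine integral_congr_ae ?_
    filter_upwards [hb.coeFn_toLp] with x hx
    rw [hx, inner_smul_right, EuclideanSpace.inner_single_right]
    simp [mul_comm]

theorem HasWeakGradient.add {f g : L2 n} {F G : L2Vec n} (hf : HasWeakGradient f F)
    (hg : HasWeakGradient g G) : HasWeakGradient (f + g) (F + G) := by
  intro φ hφ hc i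
  obtain ⟨a, b, ha, hb⟩ := exists_inner_test hφ hc i
  have h1 := hf φ hφ hc i
  have h2 := hg φ hφ hc i
  rw [ha, hb] at h1 h2 ⊢
  rw [inner_add_left, inner_add_left, h1, h2]
  ring

theorem HasWeakGradient.smul {f : L2 n} {F : L2Vec n} (c : ℝ) (hf : HasWeakGradient f F) :
    HasWeakGradient (c • f) (c • F) := by
  intro φ hφ hc i
  obtain ⟨a, b, ha, hb⟩ := exists_inner_test hφ hc i
  have h1 := hf φ hφ hc i
  rw [ha, hb] at h1 ⊢
  rw [real_inner_smul_left, real_inner_smul_left, h1]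
  ring

theorem hasWeakGradient_zero : HasWeakGradient (0 : L2 n) 0 := by
  intro φ hφ hc i
  obtain ⟨a, b, ha, hb⟩ := exists_inner_test hφ hc i
  rw [ha, hb]
  simp

theorem isClosed_hasWeakGradient :
    IsClosed {p : L2 n × L2Vec n | HasWeakGradient p.1 p.2} := by
  simp only [HasWeakGradient, ofPred_forall]
  refine isClosed_iInter fun φ => isClosed_iInter fun hφ => isClosed_iInter fun hc =>
    isClosed_iInter fun i => ?_
  obtain ⟨a, b, ha, hb⟩ := exists_inner_test hφ hc i
  simp only [ha, hb]
  exact isClosed_eq (by fun_prop) (by fun_prop)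

/-- Each component of `G` integrates to zero against all test functions, so it vanishes almost
everywhere. -/
theorem HasWeakGradient.eq_zero {G : L2Vec n} (h : HasWeakGradient 0 G) : G = 0 := by
  have h1 : ∀ i : Fin n, ∀ᵐ x, G x i = 0 := by
    intro i
    refine ae_eq_zero_of_integral_contDiff_smul_eq_zero ?_ fun φ hφ hc => ?_
    · have hi : MemLp (fun x => G x i) 2 (volume : Measure (Space n)) :=
        (EuclideanSpace.proj (𝕜 := ℝ) i).comp_memLp' (Lp.memLp G)
      exact hi.locallyIntegrable (by norm_num)
    · obtain ⟨a, b, ha, hb⟩ := exists_inner_test hφ hc i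
      have h2 := h φ hφ hc i
      rw [ha, inner_zero_left, eq_comm, neg_eq_zero] at h2
      rw [← h2]
      exact integral_congr_ae (.of_forall fun x => mul_comm _ _)
  rw [Lp.eq_zero_iff_ae_eq_zero]
  filter_upwards [ae_all_iff.2 h1] with x hx
  ext i
  exact hx i

/-- A test function, as an element of `H¹(ℝⁿ)`. -/
theorem exists_hasWeakGradient_of_contDiff {φ : Space n → ℝ} (hφ : ContDiff ℝ ∞ φ)
    (hc : HasCompactSupport φ) : ∃ (f : L2 n) (G : L2Vec n), HasWeakGradient f G ∧
      f =ᵐ[volume] φ := by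
  have hf : MemLp φ 2 (volume : Measure (Space n)) :=
    hφ.continuous.memLp_of_hasCompactSupport hc
  have hd : ∀ {ψ : Space n → ℝ}, ContDiff ℝ ∞ ψ → ∀ v : Space n,
      Continuous fun x => fderiv ℝ ψ x v :=
    fun h v => (h.continuous_fderiv (by simp)).clm_apply continuous_const
  have hg : MemLp (fun x => gradient φ x) 2 (volume : Measure (Space n)) :=
    Continuous.memLp_of_hasCompactSupport
      ((InnerProductSpace.toDual ℝ (Space n)).symm.continuous.comp
        (hφ.continuous_fderiv (by simp)))
      ((hc.fderiv ℝ).comp_left (map_zero (InnerProductSpace.toDual ℝ (Space n)).symm))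
  refine ⟨hf.toLp, hg.toLp, fun ψ hψ hcψ i => ?_, hf.coeFn_toLp⟩
  have h1 : ∫ x, hf.toLp _ x * fderiv ℝ ψ x (EuclideanSpace.single i 1)
      = ∫ x, φ x * fderiv ℝ ψ x (EuclideanSpace.single i 1) := by
    refine integral_congr_ae ?_
    filter_upwards [hf.coeFn_toLp] with x hx
    rw [hx]
  have h2 : ∫ x, hg.toLp _ x i * ψ x = ∫ x, fderiv ℝ φ x (EuclideanSpace.single i 1) * ψ x := by
    refine integral_congr_ae ?_
    filter_upwards [hg.coeFn_toLp] with x hx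
    have h3 : gradient φ x i = fderiv ℝ φ x (EuclideanSpace.single i 1) := by
      rw [← InnerProductSpace.toDual_symm_apply, EuclideanSpace.inner_single_right]
      simp [gradient]
    rw [hx, h3]
  rw [h1, h2]
  refine integral_mul_fderiv_eq_neg_fderiv_mul_of_integrable ?_ ?_ ?_
    (fun x _ => hφ.differentiable (by simp) x) (fun x _ => hψ.differentiable (by simp) x)
  · exact ((hd hφ _).mul hψ.continuous).integrable_of_hasCompactSupport hcψ.mul_left
  · exact (hφ.continuous.mul (hd hψ _)).integrable_of_hasCompactSupport hc.mul_right
  · exact (hφ.continuous.mul hψ.continuous).integrable_of_hasCompactSupport hc.mul_right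

/-- The graph of the operator `f ↦ (∇f, √V f)` with domain `H¹(ℝⁿ)`. -/
def formGraph (V : Space n →ᵇ ℝ) : Submodule ℝ (L2 n × WithLp 2 (L2Vec n × L2 n)) where
  carrier := {p | HasWeakGradient p.1 p.2.fst ∧ p.2.snd = sqrtMul V p.1}
  zero_mem' := ⟨hasWeakGradient_zero, (map_zero (sqrtMul V)).symm⟩
  add_mem' := fun {p q} hp hq => ⟨hp.1.add hq.1, by
    rw [Prod.snd_add, Prod.fst_add, WithLp.add_snd, map_add, hp.2, hq.2]⟩
  smul_mem' := fun c p hp => ⟨hp.1.smul c, by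
    rw [Prod.smul_snd, Prod.smul_fst, WithLp.smul_snd, map_smul, hp.2]⟩

theorem mem_formGraph {V : Space n →ᵇ ℝ} {f : L2 n} {F : WithLp 2 (L2Vec n × L2 n)} :
    (f, F) ∈ formGraph V ↔ HasWeakGradient f F.fst ∧ F.snd = sqrtMul V f :=
  Iff.rfl

theorem isClosedDenseGraph_formGraph (V : Space n →ᵇ ℝ) : IsClosedDenseGraph (formGraph V) where
  isClosed := by
    have h1 : Continuous fun p : L2 n × WithLp 2 (L2Vec n × L2 n) => (p.1, p.2.fst) :=
      continuous_fst.prodMk ((WithLp.fstL 2 ℝ _ _).continuous.comp continuous_snd)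
    have h2 : Continuous fun p : L2 n × WithLp 2 (L2Vec n × L2 n) => p.2.snd :=
      (WithLp.sndL 2 ℝ _ _).continuous.comp continuous_snd
    exact (isClosed_hasWeakGradient.preimage h1).inter
      (isClosed_eq h2 ((sqrtMul V).continuous.comp continuous_fst))
  eq_zero_of_zero_mem G hG := by
    obtain ⟨h1, h2⟩ := mem_formGraph.1 hG
    rw [map_zero] at h2
    exact WithLp.ofLp_injective 2 (Prod.ext h1.eq_zero h2)
  eq_zero_of_orthogonal a ha := by
    rw [Lp.eq_zero_iff_ae_eq_zero]
    refine ae_eq_zero_of_integral_contDiff_smul_eq_zero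
      ((Lp.memLp a).locallyIntegrable (by norm_num)) fun φ hφ hc => ?_
    obtain ⟨f, G, hfG, hf⟩ := exists_hasWeakGradient_of_contDiff hφ hc
    rw [← ha f (WithLp.toLp 2 (G, sqrtMul V f)) ⟨hfG, rfl⟩, L2.inner_eq_integral]
    refine integral_congr_ae ?_
    filter_upwards [hf] with x hx
    rw [hx]
    exact mul_comm _ _

theorem inner_formGraph {V : Space n →ᵇ ℝ} (hV : ∀ x, 0 < V x) {f φ : L2 n}
    {F Φ : WithLp 2 (L2Vec n × L2 n)} (hF : (f, F) ∈ formGraph V) (hΦ : (φ, Φ) ∈ formGraph V) :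
    inner ℝ F Φ = (∫ x, inner ℝ (F.fst x) (Φ.fst x)) + ∫ x, V x * f x * φ x := by
  rw [← inner_sqrtMul hV, ← (mem_formGraph.1 hF).2, ← (mem_formGraph.1 hΦ).2,
    ← MeasureTheory.L2.inner_def]
  exact WithLp.prod_inner_apply _ _

theorem IsWeakSolution.isGraphSolution {V : Space n →ᵇ ℝ} (hV : ∀ x, 0 < V x) {u₀ u₁ : L2 n}
    {u ut : ℝ → L2 n} {Du : ℝ → L2Vec n} (h : IsWeakSolution V u₀ u₁ u ut Du) :
    IsGraphSolution (formGraph V) u ut (fun t => WithLp.toLp 2 (Du t, sqrtMul V (u t))) := by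
  have hmem : ∀ t, 0 ≤ t → (u t, WithLp.toLp 2 (Du t, sqrtMul V (u t))) ∈ formGraph V :=
    fun t ht => ⟨h.hasWeakGradient t ht, rfl⟩
  refine ⟨hmem, ?_, h.hasDerivWithinAt, h.continuousOn_deriv, fun φ Φ hφ t ht => ?_⟩
  · exact (WithLp.prod_continuous_toLp 2 _ _).comp_continuousOn
      (h.continuousOn_gradient.prodMk ((sqrtMul V).continuous.comp_continuousOn h.continuousOn))
  · simp only [inner_formGraph hV (hmem t ht.le) hφ, L2.inner_eq_integral]
    exact h.equation φ Φ.fst hφ.1 t ht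

theorem IsGraphSolution.isWeakSolution {V : Space n →ᵇ ℝ} (hV : ∀ x, 0 < V x)
    {u ut : ℝ → L2 n} {F : ℝ → WithLp 2 (L2Vec n × L2 n)}
    (h : IsGraphSolution (formGraph V) u ut F) :
    IsWeakSolution V (u 0) (ut 0) u ut (fun t => (F t).fst) where
  hasWeakGradient t ht := (h.mem t ht).1
  continuousOn := h.continuousOn
  continuousOn_gradient := (WithLp.fstL 2 ℝ _ _).continuous.comp_continuousOn h.continuousOn_snd
  hasDerivWithinAt := h.hasDerivWithinAt
  continuousOn_deriv := h.continuousOn_deriv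
  initial := rfl
  initial_deriv := rfl
  equation φ Φ hφ t ht := by
    have hmem : (φ, WithLp.toLp 2 (Φ, sqrtMul V φ)) ∈ formGraph V := ⟨hφ, rfl⟩
    have h1 := h.equation _ _ hmem t ht
    simp only [inner_formGraph hV (h.mem t ht.le) hmem, L2.inner_eq_integral] at h1
    exact h1

/-- Duality between the weights `1 / V` and `V`. -/
theorem inner_add_le {V : Space n →ᵇ ℝ} (hV : ∀ x, 0 < V x) {u₀ u₁ : L2 n}
    (hK : Integrable (fun x => |u₁ x + u₀ x| ^ 2 / V x)) (w : L2 n) :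
    inner ℝ (u₀ + u₁) w ≤ 1 / 2 * (∫ x, |u₁ x + u₀ x| ^ 2 / V x) + 1 / 2 * ‖sqrtMul V w‖ ^ 2 := by
  rw [← integral_mul_sq hV, ← integral_const_mul, ← integral_const_mul,
    ← integral_add (hK.const_mul _) ((integrable_mul_sq hV w).const_mul _),
    MeasureTheory.L2.inner_def]
  refine integral_mono_ae (L2.integrable_inner _ _)
    ((hK.const_mul _).add ((integrable_mul_sq hV w).const_mul _)) ?_
  filter_upwards [Lp.coeFn_add u₀ u₁] with x hx
  rw [hx, Pi.add_apply, sq_abs, sq_abs]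
  have hx := hV x
  change w x * (u₀ x + u₁ x) ≤ _
  -- Pointwise Young's inequality, with the defect written as a square over 2V.
  have h1 : 1 / 2 * ((u₁ x + u₀ x) ^ 2 / V x) + 1 / 2 * (V x * w x ^ 2) - w x * (u₀ x + u₁ x)
      = (u₁ x + u₀ x - V x * w x) ^ 2 / (2 * V x) := by
    field_simp
    ring
  have h2 : 0 ≤ (u₁ x + u₀ x - V x * w x) ^ 2 / (2 * V x) := by positivity
  linarith

theorem norm_sqrtMul_sq_le {V : Space n →ᵇ ℝ} (hV : ∀ x, 0 < V x) {M : ℝ} (hM : ∀ x, V x ≤ M)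
    (f : L2 n) : ‖sqrtMul V f‖ ^ 2 ≤ M * ‖f‖ ^ 2 := by
  rw [← integral_mul_sq hV, ← integral_norm_sq, ← integral_const_mul]
  refine integral_mono (integrable_mul_sq hV f) ((integrable_norm_sq f).const_mul M) fun x => ?_
  exact mul_le_mul_of_nonneg_right (hM x) (sq_nonneg _)

end Concrete

end DampedWave

end

/-! ### The decay theorem. -/

theorem theorem1p3 (M : ℝ) :
    ∃ C : ℝ, 0 < C ∧ ∀ n : ℕ, 1 ≤ n →
      ∀ V : BoundedContinuousFunction (DampedWave.Space n) ℝ, (∀ x, 0 < V x) → (∀ x, V x ≤ M) →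
      ∀ (u₀ u₁ : DampedWave.L2 n) (Du₀ : DampedWave.L2Vec n),
        DampedWave.HasWeakGradient u₀ Du₀ →
        MeasureTheory.Integrable (fun x => |u₁ x + u₀ x| ^ 2 / V x) MeasureTheory.volume →
        ∃ (u ut : ℝ → DampedWave.L2 n) (Du : ℝ → DampedWave.L2Vec n),
          DampedWave.IsWeakSolution V u₀ u₁ u ut Du ∧
          (∀ (v vt : ℝ → DampedWave.L2 n) (Dv : ℝ → DampedWave.L2Vec n),
            DampedWave.IsWeakSolution V u₀ u₁ v vt Dv →
              ∀ t, 0 ≤ t → v t = u t ∧ vt t = ut t ∧ Dv t = Du t) ∧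
          ∀ t : ℝ, 0 ≤ t →
            (1 + t) ^ 2 * DampedWave.energy V (u t) (ut t) (Du t) ≤
              C * (‖u₀‖ ^ 2 + ‖u₁‖ ^ 2 + ‖Du₀‖ ^ 2 + ∫ x, |u₁ x + u₀ x| ^ 2 / V x) ∧
            (1 + t) * ‖u t‖ ^ 2 ≤
              C * (‖u₀‖ ^ 2 + ‖u₁‖ ^ 2 + ‖Du₀‖ ^ 2 + ∫ x, |u₁ x + u₀ x| ^ 2 / V x) := by
  -- The data contribute at most 4‖u₁‖² + (5/2 + 3|M|)‖u₀‖² + 3‖Du₀‖² + ½K₀²; the factor ¼ in front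
  -- of (1+t)‖u‖² multiplies this by 4.
  refine ⟨16 + 12 * |M|, by positivity, fun n _ V hV hM u₀ u₁ Du₀ hDu₀ hK => ?_⟩
  have hΓ := DampedWave.isClosedDenseGraph_formGraph V
  have h₀ : (u₀, WithLp.toLp 2 (Du₀, DampedWave.sqrtMul V u₀)) ∈ DampedWave.formGraph V :=
    ⟨hDu₀, rfl⟩
  obtain ⟨u, ut, F, hsol, hu0, hut0, hest⟩ := hΓ.exists_solution (u₁ := u₁) h₀
  have hweak := hsol.isWeakSolution hV
  rw [hu0, hut0] at hweak
  refine ⟨u, ut, fun t => (F t).fst, hweak, fun v vt Dv h t ht => ?_, fun t ht => ?_⟩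
  · obtain ⟨h1, h2, h3⟩ := (h.isGraphSolution hV).unique hΓ hsol (h.initial.trans hu0.symm)
      (h.initial_deriv.trans hut0.symm) ht
    exact ⟨h1, h2, congrArg WithLp.fst h3⟩
  · have hFc : IntervalIntegrable F MeasureTheory.volume 0 t :=
      (hsol.continuousOn_snd.mono (by rw [Set.uIcc_of_le ht]; exact Set.Icc_subset_Ici_self)
        ).intervalIntegrable
    have huc : IntervalIntegrable u MeasureTheory.volume 0 t :=
      (hsol.continuousOn.mono (by rw [Set.uIcc_of_le ht]; exact Set.Icc_subset_Ici_self)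
        ).intervalIntegrable
    -- Multiplication by √V commutes with the time integral, so √V ∫u is a component of ∫F and
    -- ½‖∫F‖² dominates the weighted term of the duality bound.
    have hW : (∫ s in (0 : ℝ)..t, F s).snd = DampedWave.sqrtMul V (∫ s in (0 : ℝ)..t, u s) := by
      rw [← ContinuousLinearMap.intervalIntegral_comp_comm _ huc]
      refine ((WithLp.sndL 2 ℝ _ _).intervalIntegral_comp_comm hFc).symm.trans ?_
      refine intervalIntegral.integral_congr fun s hs => ?_
      rw [Set.uIcc_of_le ht] at hs
      exact (hsol.mem s hs.1).2
    have hWn : ‖DampedWave.sqrtMul V (∫ s in (0 : ℝ)..t, u s)‖ ^ 2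
        ≤ ‖∫ s in (0 : ℝ)..t, F s‖ ^ 2 := by
      rw [WithLp.prod_norm_sq_eq_of_L2, ← hW]
      exact le_add_of_nonneg_left (sq_nonneg _)
    have hF0 : ‖WithLp.toLp 2 (Du₀, DampedWave.sqrtMul V u₀)‖ ^ 2
        ≤ ‖Du₀‖ ^ 2 + |M| * ‖u₀‖ ^ 2 := by
      rw [WithLp.prod_norm_sq_eq_of_L2]
      exact add_le_add_right ((DampedWave.norm_sqrtMul_sq_le hV hM u₀).trans
        (mul_le_mul_of_nonneg_right (le_abs_self M) (sq_nonneg _))) _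
    have hE : DampedWave.energy V (u t) (ut t) (F t).fst
        = 1 / 2 * (‖ut t‖ ^ 2 + ‖F t‖ ^ 2) := by
      rw [DampedWave.energy_eq hV, WithLp.prod_norm_sq_eq_of_L2, ← (hsol.mem t ht).2]
    have hdual := DampedWave.inner_add_le hV hK (∫ s in (0 : ℝ)..t, u s)
    have hcross : 2 * inner ℝ u₁ u₀ ≤ ‖u₁‖ ^ 2 + ‖u₀‖ ^ 2 := by
      nlinarith [real_inner_le_norm u₁ u₀, sq_nonneg (‖u₁‖ - ‖u₀‖)]
    have hK0 : 0 ≤ ∫ x, |u₁ x + u₀ x| ^ 2 / V x :=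
      MeasureTheory.integral_nonneg fun x => div_nonneg (sq_nonneg _) (hV x).le
    have hmain := hest t ht
    have p1 : 0 ≤ (1 + t) ^ 2 * (1 / 2 * (‖ut t‖ ^ 2 + ‖F t‖ ^ 2)) := by positivity
    have p2 : 0 ≤ (1 + t) * ‖u t‖ ^ 2 := by positivity
    have p3 : 0 ≤ |M| * (‖u₁‖ ^ 2 + ‖Du₀‖ ^ 2 + ∫ x, |u₁ x + u₀ x| ^ 2 / V x) := by positivity
    have p4 : 0 ≤ |M| * ‖u₀‖ ^ 2 := by positivity
    have p5 := sq_nonneg ‖u₀‖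
    have p6 := sq_nonneg ‖u₁‖
    have p7 := sq_nonneg ‖Du₀‖
    rw [hE]
    constructor <;> linarith
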